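/- Let $n_1\le n_2$, let $\mathcal{A}:\mathbb{R}^{n_1\times n_2}\to\mathbb{R}^m$ be linear with nullspace $\mathcal{N}(\mathcal{A})$, let $0<p<1$ and $0\le k\le n_1$. For $X\in\mathbb{R}^{n_1\times n_2}$ let $\sigma_1(X)\ge\dots\ge\sigma_{n_1}(X)\ge 0$ be its singular values, put $\sigma_i(X)=0$ for $i>n_1$, and let $\operatorname{Tr}|X|^p=\sum_{i=1}^{n_1}\sigma_i^p(X)$. For $X_0\in\mathbb{R}^{n_1\times n_2}$ consider the problem $$\text{minimize } \operatorname{Tr}|X|^p\quad\text{subject to}\quad \mathcal{A}(X)=\mathcal{A}(X_0).\qquad (\ast)$$ (Sufficiency) If $$\sum_{i=1}^{2k}\sigma_i^p(W)\le\sum_{i=2k+1}^{n_1}\sigma_i^p(W)\quad\text{for all } W\in\mathcal{N}(\mathcal{A}),$$ then for every $X_0$ with $\operatorname{rank}(X_0)=k$ the matrix $X_0$ is the unique global minimizer of $(\ast)$. (Necessity) If every $X_0$ with $\operatorname{rank}(X_0)=k$ is a global minimizer of its problem $(\ast)$ (in particular, if it is always the unique one), then $$\sum_{i=1}^{k}\sigma_i^p(W)\le\sum_{i=k+1}^{n_1}\sigma_i^p(W)\quad\text{for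 all } W\in\mathcal{N}(\mathcal{A}).$$ -/

import Mathlib

namespace SchattenRecovery

/-- Singular values of a real matrix in decreasing order, with multiplicity, indexed from `0`:
`sigma X i` is the `(i + 1)`-st largest singular value, and it is `0` for `i ≥ min n₁ n₂`. -/
noncomputable def sigma {n₁ n₂ : ℕ} (X : Matrix (Fin n₁) (Fin n₂) ℝ) (i : ℕ) : ℝ :=
  (Matrix.toEuclideanLin X).singularValues i

/-- The Schatten-`p` objective `Tr |X| ^ p`, the sum of the `p`-th powers of the `n₁` singular
values of an `n₁ × n₂` matrix, where `n₁ ≤ n₂`. -/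
noncomputable def schattenPow {n₁ n₂ : ℕ} (p : ℝ) (X : Matrix (Fin n₁) (Fin n₂) ℝ) : ℝ :=
  ∑ i ∈ Finset.range n₁, sigma X i ^ p

/-- `X` is a global minimizer of `Tr |Z| ^ p` subject to `𝒜 Z = y`. -/
def IsGlobalMinimizer {n₁ n₂ m : ℕ} (𝒜 : Matrix (Fin n₁) (Fin n₂) ℝ →ₗ[ℝ] (Fin m → ℝ))
    (p : ℝ) (y : Fin m → ℝ) (X : Matrix (Fin n₁) (Fin n₂) ℝ) : Prop :=
  𝒜 X = y ∧ IsMinOn (schattenPow p) {Z | 𝒜 Z = y} X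

end SchattenRecovery

/-! For `0 < p < 1` the functional `Tr|·|^p` obeys a triangle inequality
(`sum_singularValues_rpow_add_le`). Indeed `x ^ p` is a positive mixture of the functions `min x t`,
and `∑ min σ_i t` is subadditive: splitting off the singular values above `t` leaves a low-rank
part, controlled by Weyl's inequality, and a remainder, controlled by the triangle inequality for
the trace norm.

Sufficiency: let `X` have rank `k` and let `P` project onto its range. The triangle inequality for
`X = P(X + W) - PW` bounds `Tr|X|^p` by the `k` leading terms of `X + W` plus those of `W`, while
Weyl bounds the tail of `W` past `2k` by the tail of `X + W` past `k`. Adding the two gives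
`sum_singularValues_rpow_add_ge`. For `k > 0` the nullspace condition then leaves a surplus of at
least `σ_{k+1}(W)^p`, positive unless `W = 0`.

Necessity: let `X` cancel the `k` leading singular values of `W`. Minimality gives `Tr|X|^p ≤ Tr|W +
X|^p`, so `Tr|W|^p ≤ 2 Tr|W + X|^p`, which is about twice the tail of `W`. -/

namespace SchattenRecovery

/-! ### Maps in diagonal form -/

section LinearMaps

open Module
open scoped RealInnerProductSpace

variable {E F : Type*} [NormedAddCommGroup E] [InnerProductSpace ℝ E]
  [NormedAddCommGroup F] [InnerProductSpace ℝ F]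

/-- The linear map `x ↦ ∑ i, c i * ⟪v i, x⟫ • u i`. -/
noncomputable def diagMap {n : ℕ} (u : Fin n → F) (v : Fin n → E) (c : Fin n → ℝ) : E →ₗ[ℝ] F :=
  ∑ i, c i • (innerₛₗ ℝ (v i)).smulRight (u i)

theorem diagMap_apply {n : ℕ} (u : Fin n → F) (v : Fin n → E) (c : Fin n → ℝ) (x : E) :
    diagMap u v c x = ∑ i, (c i * ⟪v i, x⟫) • u i := by
  simp [diagMap, LinearMap.sum_apply, mul_smul]

theorem diagMap_add {n : ℕ} (u : Fin n → F) (v : Fin n → E) (c d : Fin n → ℝ) :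
    diagMap u v (c + d) = diagMap u v c + diagMap u v d := by
  simp [diagMap, add_smul, Finset.sum_add_distrib]

theorem finrank_range_diagMap_le {n : ℕ} (u : Fin n → F) (v : Fin n → E) (c : Fin n → ℝ) :
    finrank ℝ (diagMap u v c).range ≤ (Finset.univ.filter fun i => c i ≠ 0).card := by
  classical
  have h : (diagMap u v c).range ≤
      Submodule.span ℝ (((Finset.univ.filter fun i => c i ≠ 0).image u : Finset F) : Set F) := by
    rintro _ ⟨x, rfl⟩
    rw [diagMap_apply]
    refine Submodule.sum_mem _ fun i _ => ?_
    by_cases hi : c i = 0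
    · simp [hi]
    · exact Submodule.smul_mem _ _ (Submodule.subset_span (by simp; exact ⟨i, hi, rfl⟩))
  exact (Submodule.finrank_mono h).trans
    ((finrank_span_finset_le_card _).trans Finset.card_image_le)

theorem diagMap_apply_orthonormal {n : ℕ} (u : Fin n → F) {v : Fin n → E} (hv : Orthonormal ℝ v)
    (c : Fin n → ℝ) (i : Fin n) : diagMap u v c (v i) = c i • u i := by
  rw [diagMap_apply, Finset.sum_eq_single i]
  · simp [hv.1 i]
  · intro j _ hj
    simp [hv.2 hj]
  · simp

theorem norm_sq_diagMap_apply {n : ℕ} {u : Fin n → F} (hu : Orthonormal ℝ u) (v : Fin n → E)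
    (c : Fin n → ℝ) (x : E) : ‖diagMap u v c x‖ ^ 2 = ∑ i, (c i * ⟪v i, x⟫) ^ 2 := by
  rw [diagMap_apply, ← real_inner_self_eq_norm_sq, hu.inner_sum]
  simp [pow_two]

/-- Each rank-one term contributes at most its weight, by AM-GM and Bessel's inequality for both
families. -/
theorem sum_inner_diagMap_le {n l : ℕ} {u : Fin n → F} {v : Fin n → E} (hu : ∀ i, ‖u i‖ ≤ 1)
    (hv : ∀ i, ‖v i‖ ≤ 1) (c : Fin n → ℝ) (hc : ∀ i, 0 ≤ c i) {u' : Fin l → F} {v' : Fin l → E}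
    (hu' : Orthonormal ℝ u') (hv' : Orthonormal ℝ v') :
    ∑ i, ⟪u' i, diagMap u v c (v' i)⟫ ≤ ∑ j, c j := by
  simp only [diagMap_apply, inner_sum, inner_smul_right]
  rw [Finset.sum_comm]
  refine Finset.sum_le_sum fun j _ => ?_
  simp only [mul_assoc]
  rw [← Finset.mul_sum]
  refine mul_le_of_le_one_right (hc j) ?_
  have h1 : ∑ i, ⟪u' i, u j⟫ ^ 2 ≤ ‖u j‖ ^ 2 := by
    simpa using hu'.sum_inner_products_le (u j) (s := Finset.univ)
  have h2 : ∑ i, ⟪v' i, v j⟫ ^ 2 ≤ ‖v j‖ ^ 2 := by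
    simpa using hv'.sum_inner_products_le (v j) (s := Finset.univ)
  have h3 : ‖u j‖ ^ 2 ≤ 1 := pow_le_one₀ (norm_nonneg _) (hu j)
  have h4 : ‖v j‖ ^ 2 ≤ 1 := pow_le_one₀ (norm_nonneg _) (hv j)
  have h5 : ∑ i, ⟪v j, v' i⟫ * ⟪u' i, u j⟫ ≤
      ∑ i, (1 / 2 * ⟪u' i, u j⟫ ^ 2 + 1 / 2 * ⟪v' i, v j⟫ ^ 2) := by
    refine Finset.sum_le_sum fun i _ => ?_
    rw [real_inner_comm]
    nlinarith [sq_nonneg (⟪u' i, u j⟫ - ⟪v' i, v j⟫)]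
  rw [Finset.sum_add_distrib, ← Finset.mul_sum, ← Finset.mul_sum] at h5
  linarith

/-! ### Singular value decomposition, minimax principle, Weyl inequality -/

variable [FiniteDimensional ℝ E] [FiniteDimensional ℝ F]

/-- Singular value decomposition of a linear map whose codomain is at most as large as its domain. -/
theorem exists_eq_diagMap (T : E →ₗ[ℝ] F) {n : ℕ} (hF : finrank ℝ F = n) (hE : n ≤ finrank ℝ E) :
    ∃ (u : Fin n → F) (v : Fin n → E), Orthonormal ℝ u ∧ Orthonormal ℝ v ∧
      T = diagMap u v fun i => T.singularValues i := by
  set hT := T.isSymmetric_adjoint_comp_self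
  let b := hT.eigenvectorBasis rfl
  have hb : ∀ i j, ⟪T (b i), T (b j)⟫ = if i = j then T.singularValues i ^ 2 else 0 := by
    intro i j
    rw [← LinearMap.adjoint_inner_left, ← LinearMap.comp_apply]
    simp only [b, hT.apply_eigenvectorBasis, inner_smul_left]
    rw [orthonormal_iff_ite.1 (hT.eigenvectorBasis rfl).orthonormal, T.sq_singularValues_fin rfl]
    split_ifs <;> simp
  let e : Fin n → Fin (finrank ℝ E) := Fin.castLE hE
  let w : Fin n → F := fun i => (T.singularValues i)⁻¹ • T (b (e i))
  have hw : Orthonormal ℝ ({i : Fin n | T.singularValues i ≠ 0}.domRestrict w) := by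
    rw [orthonormal_iff_ite]
    rintro ⟨i, hi⟩ ⟨j, hj⟩
    simp only [Set.domRestrict_apply, w, inner_smul_left, inner_smul_right, hb, Subtype.mk.injEq]
    have hij : e i = e j ↔ i = j := (Fin.castLE_injective hE).eq_iff
    simp only [hij]
    split_ifs with h
    · subst h
      have : T.singularValues i ≠ 0 := hi
      simp [e]
      field_simp
    · simp
  -- Where the singular value is zero any completion serves, since its coefficient vanishes.
  obtain ⟨u, hu⟩ := hw.exists_orthonormalBasis_extension_of_card_eq (by simp [hF])
  refine ⟨u, b ∘ e, u.orthonormal, b.orthonormal.comp _ (Fin.castLE_injective hE), ?_⟩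
  have hz : ∀ j : Fin (finrank ℝ E), T.singularValues j = 0 → T (b j) = 0 := fun j hj => by
    rw [← inner_self_eq_zero (𝕜 := ℝ), hb]; simp [hj]
  refine b.toBasis.ext fun j => ?_
  simp only [OrthonormalBasis.coe_toBasis, diagMap_apply, Function.comp,
    orthonormal_iff_ite.1 b.orthonormal]
  by_cases hj : (j : ℕ) < n
  · rw [Finset.sum_eq_single ⟨j, hj⟩]
    · have : e ⟨j, hj⟩ = j := rfl
      by_cases h0 : T.singularValues j = 0
      · simp [h0, hz j h0]
      · rw [hu ⟨j, hj⟩ h0]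
        simp [w, this, h0]
    · intro i _ hi
      have : e i ≠ j := fun h => hi (Fin.ext (by simp [← h, e]))
      simp [this]
    · simp
  · rw [hz j, Finset.sum_eq_zero]
    · intro i _
      have : e i ≠ j := fun h => hj (by simp [← h, e])
      simp [this]
    · rw [T.singularValues_eq_zero_iff_le_finrank_range]
      have := T.range.finrank_le
      omega

/-- Upper half of the minimax principle for singular values. -/
theorem singularValues_le_of_forall_mem (hEF : finrank ℝ F ≤ finrank ℝ E) (T : E →ₗ[ℝ] F) {i : ℕ}
    {s : ℝ} (hs : 0 ≤ s) (V : Submodule ℝ E) (hV : finrank ℝ E ≤ finrank ℝ V + i)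
    (h : ∀ x ∈ V, ‖T x‖ ≤ s * ‖x‖) : T.singularValues i ≤ s := by
  obtain ⟨u, v, hu, hv, hT⟩ := exists_eq_diagMap T rfl hEF
  by_cases h0 : T.singularValues i = 0
  · rwa [h0]
  have hi : i < finrank ℝ F := by
    have := T.range.finrank_le
    rw [T.singularValues_eq_zero_iff_le_finrank_range] at h0
    omega
  let w : Fin (i + 1) → E := v ∘ Fin.castLE hi
  have hw : Orthonormal ℝ w := hv.comp _ (Fin.castLE_injective _)
  have hdim := finrank_span_eq_card hw.linearIndependent
  rw [Fintype.card_fin] at hdim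
  -- The dimensions, at least `finrank ℝ E - i` and exactly `i + 1`, force a nonzero intersection.
  obtain ⟨x, hx, hx0⟩ : ∃ x ∈ V ⊓ Submodule.span ℝ (Set.range w), x ≠ 0 := by
    apply Submodule.exists_mem_ne_zero_of_ne_bot
    intro hbot
    have h1 := Submodule.finrank_sup_add_finrank_inf_eq V (Submodule.span ℝ (Set.range w))
    have h2 := (V ⊔ Submodule.span ℝ (Set.range w)).finrank_le
    rw [hbot, finrank_bot] at h1
    omega
  obtain ⟨hxV, hxw⟩ := hx
  obtain ⟨a, rfl⟩ := (Submodule.mem_span_range_iff_exists_fun ℝ).1 hxw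
  set x := ∑ j, a j • w j with hxdef
  have hxn : ‖x‖ ^ 2 = ∑ j, a j ^ 2 := by
    rw [← real_inner_self_eq_norm_sq, hxdef, hw.inner_sum]; simp [pow_two]
  have hTx : T.singularValues i ^ 2 * ‖x‖ ^ 2 ≤ ‖T x‖ ^ 2 := by
    have h3 : T x = ∑ j, (a j * T.singularValues j) • (u ∘ Fin.castLE hi) j := by
      rw [hxdef, map_sum]
      refine Finset.sum_congr rfl fun j _ => ?_
      rw [map_smul, mul_smul]
      congr 1
      conv_lhs => rw [hT]
      exact diagMap_apply_orthonormal u hv _ _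
    have hu' : Orthonormal ℝ (u ∘ Fin.castLE hi) := hu.comp _ (Fin.castLE_injective _)
    rw [hxn, h3, ← real_inner_self_eq_norm_sq, hu'.inner_sum, Finset.mul_sum]
    refine Finset.sum_le_sum fun j _ => ?_
    have h4 : T.singularValues i ≤ T.singularValues j := T.singularValues_antitone (by omega)
    have h5 := pow_le_pow_left₀ (T.singularValues_nonneg i) h4 2
    simp only [conj_trivial]
    nlinarith [sq_nonneg (a j)]
  have hpos : 0 < ‖x‖ := norm_pos_iff.2 hx0
  have h6 : T.singularValues i * ‖x‖ ≤ ‖T x‖ :=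
    le_of_sq_le_sq (by rw [mul_pow]; exact hTx) (norm_nonneg _)
  exact le_of_mul_le_mul_right (h6.trans (h x hxV)) hpos

/-- Lower half of the minimax principle for singular values. -/
theorem exists_forall_mem_norm_le (hEF : finrank ℝ F ≤ finrank ℝ E) (T : E →ₗ[ℝ] F) (i : ℕ) :
    ∃ V : Submodule ℝ E, finrank ℝ E ≤ finrank ℝ V + i ∧
      ∀ x ∈ V, ‖T x‖ ≤ T.singularValues i * ‖x‖ := by
  classical
  obtain ⟨u, v, hu, hv, hT⟩ := exists_eq_diagMap T rfl hEF
  let s := (Finset.univ.filter fun j : Fin (finrank ℝ F) => (j : ℕ) < i).image v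
  refine ⟨(Submodule.span ℝ (s : Set E))ᗮ, ?_, fun x hx => ?_⟩
  · have h1 := (Submodule.span ℝ (s : Set E)).finrank_add_finrank_orthogonal
    have h2 : finrank ℝ (Submodule.span ℝ (s : Set E)) ≤ i := by
      refine (finrank_span_finset_le_card s).trans (Finset.card_image_le.trans ?_)
      rw [← Finset.card_map Fin.valEmbedding]
      refine (Finset.card_le_card (t := Finset.range i) ?_).trans (by simp)
      intro j
      simp only [Finset.mem_map, Finset.mem_filter, Finset.mem_range]
      rintro ⟨a, ha, rfl⟩
      exact ha.2
    omega
  · refine le_of_sq_le_sq ?_ (mul_nonneg (T.singularValues_nonneg i) (norm_nonneg x))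
    have h0 : ‖T x‖ ^ 2 = ∑ j : Fin (finrank ℝ F), (T.singularValues j * ⟪v j, x⟫) ^ 2 := by
      conv_lhs => rw [hT]
      exact norm_sq_diagMap_apply hu v _ x
    have h1 : ∑ j, ⟪v j, x⟫ ^ 2 ≤ ‖x‖ ^ 2 := by
      simpa using hv.sum_inner_products_le x (s := Finset.univ)
    rw [h0, mul_pow]
    refine le_trans ?_ (mul_le_mul_of_nonneg_left h1 (sq_nonneg _))
    rw [Finset.mul_sum]
    refine Finset.sum_le_sum fun j _ => ?_
    by_cases hj : (j : ℕ) < i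
    · have : ⟪v j, x⟫ = 0 := hx _ (Submodule.subset_span (by simp [s]; exact ⟨j, hj, rfl⟩))
      simp [this]
    · rw [mul_pow]
      exact mul_le_mul_of_nonneg_right (pow_le_pow_left₀ (T.singularValues_nonneg _)
        (T.singularValues_antitone (not_lt.1 hj)) 2) (sq_nonneg _)

theorem singularValues_mono (hEF : finrank ℝ F ≤ finrank ℝ E) {S T : E →ₗ[ℝ] F}
    (h : ∀ x, ‖S x‖ ≤ ‖T x‖) (i : ℕ) : S.singularValues i ≤ T.singularValues i := by
  obtain ⟨V, hV, hT⟩ := exists_forall_mem_norm_le hEF T i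
  exact singularValues_le_of_forall_mem hEF S (T.singularValues_nonneg i) V hV
    fun x hx => (h x).trans (hT x hx)

/-- The Weyl inequality for a perturbation of rank at most `m`. -/
theorem singularValues_add_le_of_finrank_range_le (hEF : finrank ℝ F ≤ finrank ℝ E)
    (T R : E →ₗ[ℝ] F) {m : ℕ} (hR : finrank ℝ R.range ≤ m) (i : ℕ) :
    (T + R).singularValues (i + m) ≤ T.singularValues i := by
  obtain ⟨V, hV, hT⟩ := exists_forall_mem_norm_le hEF T i
  refine singularValues_le_of_forall_mem hEF (T + R) (T.singularValues_nonneg i) (V ⊓ R.ker) ?_ ?_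
  · have h1 := Submodule.finrank_sup_add_finrank_inf_eq V R.ker
    have h2 := (V ⊔ R.ker).finrank_le
    have h3 := R.finrank_range_add_finrank_ker
    omega
  · rintro x ⟨hxV, hxR⟩
    have : R x = 0 := hxR
    simpa [this] using hT x hxV

/-! ### Subadditivity of truncated singular value sums -/

/-- Pairing `Z` with its own singular vectors turns the sum of its singular values into an
expression linear in `Z`, so each summand can be bounded separately. -/
theorem sum_singularValues_diagMap_add_le {n : ℕ} (hF : finrank ℝ F = n) (hE : n ≤ finrank ℝ E)
    {u u' : Fin n → F} {v v' : Fin n → E} (hu : Orthonormal ℝ u) (hv : Orthonormal ℝ v)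
    (hu' : Orthonormal ℝ u') (hv' : Orthonormal ℝ v') (c c' : Fin n → ℝ) (hc : ∀ i, 0 ≤ c i)
    (hc' : ∀ i, 0 ≤ c' i) :
    ∑ i : Fin n, (diagMap u v c + diagMap u' v' c').singularValues i ≤ ∑ j, c j + ∑ j, c' j := by
  set Z := diagMap u v c + diagMap u' v' c' with hZ
  obtain ⟨a, b, ha, hb, h⟩ := exists_eq_diagMap Z hF hE
  have h1 : ∀ i : Fin n, Z.singularValues i = ⟪a i, Z (b i)⟫ := by
    intro i
    have : Z (b i) = Z.singularValues i • a i := by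
      conv_lhs => rw [h]
      exact diagMap_apply_orthonormal a hb _ i
    rw [this, inner_smul_right]
    simp [ha.1 i]
  simp only [h1]
  simp only [hZ, LinearMap.add_apply, inner_add_right, Finset.sum_add_distrib]
  exact add_le_add
    (sum_inner_diagMap_le (fun i => (hu.1 i).le) (fun i => (hv.1 i).le) c hc ha hb)
    (sum_inner_diagMap_le (fun i => (hu'.1 i).le) (fun i => (hv'.1 i).le) c' hc' ha hb)

theorem sum_min_singularValues_add_le {n : ℕ} (hF : finrank ℝ F = n) (hE : n ≤ finrank ℝ E)
    (A B : E →ₗ[ℝ] F) {t : ℝ} (ht : 0 < t) :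
    ∑ i ∈ Finset.range n, min ((A + B).singularValues i) t ≤
      ∑ i ∈ Finset.range n, min (A.singularValues i) t +
        ∑ i ∈ Finset.range n, min (B.singularValues i) t := by
  have key : ∀ T : E →ₗ[ℝ] F, ∃ (u : Fin n → F) (v : Fin n → E) (c : Fin n → ℝ) (R : E →ₗ[ℝ] F)
      (a : ℕ), Orthonormal ℝ u ∧ Orthonormal ℝ v ∧ (∀ i, 0 ≤ c i) ∧ T = diagMap u v c + R ∧
      finrank ℝ R.range ≤ a ∧
      a * t + ∑ i, c i ≤ ∑ i ∈ Finset.range n, min (T.singularValues i) t := by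
    intro T
    obtain ⟨u, v, hu, hv, h⟩ := exists_eq_diagMap T hF hE
    let c : Fin n → ℝ := fun i => if T.singularValues i ≤ t then T.singularValues i else 0
    let d : Fin n → ℝ := fun i => if T.singularValues i ≤ t then 0 else T.singularValues i
    -- The rank bound `a` is the number of nonzero `d i`, that is, of singular values above `t`.
    refine ⟨u, v, c, diagMap u v d, _, hu, hv, fun i => ?_, ?_, finrank_range_diagMap_le u v d, ?_⟩
    · simp only [c]
      split_ifs
      exacts [T.singularValues_nonneg i, le_rfl]
    · rw [← diagMap_add]
      conv_lhs => rw [h]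
      congr 1
      ext i
      simp only [c, d, Pi.add_apply]
      split_ifs <;> simp
    · rw [Finset.sum_range, ← nsmul_eq_mul, ← Finset.sum_const, Finset.sum_filter,
        ← Finset.sum_add_distrib]
      refine Finset.sum_le_sum fun i _ => ?_
      simp only [c, d]
      split_ifs with h1 h2 h2
      · simp at h2
      · simp [h1]
      · simp [(not_le.1 h1).le]
      · simp [(not_le.1 h1).le, ht.le] at *
  obtain ⟨u, v, c, R, a, hu, hv, hc, hA, hR, hAs⟩ := key A
  obtain ⟨u', v', c', R', a', hu', hv', hc', hB, hR', hBs⟩ := key B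
  set Z := diagMap u v c + diagMap u' v' c' with hZ
  have hAB : A + B = Z + (R + R') := by rw [hA, hB, hZ]; abel
  have hrank : finrank ℝ (R + R').range ≤ a + a' := by
    have h1 : (R + R').range ≤ R.range ⊔ R'.range := LinearMap.range_add_le R R'
    have h2 := Submodule.finrank_mono h1
    have h3 := Submodule.finrank_add_le_finrank_add_finrank R.range R'.range
    omega
  have hsum := sum_singularValues_diagMap_add_le hF hE hu hv hu' hv' c c' hc hc'
  rw [← hZ, ← Finset.sum_range (fun i => Z.singularValues i)] at hsum
  have hle : ∑ i ∈ Finset.range n, min ((A + B).singularValues i) t ≤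
      ((a + a' : ℕ) : ℝ) * t + ∑ i ∈ Finset.range n, Z.singularValues i := by
    -- The range is lengthened so that, once the first `a + a'` terms are bounded by `t`, Weyl
    -- matches the other `n` with those of `Z`.
    calc _ ≤ ∑ i ∈ Finset.range (a + a' + n), min ((A + B).singularValues i) t :=
          Finset.sum_le_sum_of_subset_of_nonneg (Finset.range_mono (by omega))
            fun i _ _ => le_min ((A + B).singularValues_nonneg i) ht.le
      _ ≤ _ := by
          rw [Finset.sum_range_add]
          refine add_le_add ?_ (Finset.sum_le_sum fun i _ => ?_)
          · refine (Finset.sum_le_sum fun i _ => min_le_right _ t).trans ?_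
            simp
          · refine (min_le_left _ _).trans ?_
            rw [hAB, add_comm (a + a')]
            exact singularValues_add_le_of_finrank_range_le (hF ▸ hE) Z _ hrank i
  push_cast at hle
  linarith

end LinearMaps

/-! ### Powers as mixtures of truncations -/

section Powers

open MeasureTheory Set

/-- Split at `t = x`: convergence at `0` needs `p > 0`, at infinity `p < 1`. -/
theorem min_mul_rpow_integral {p : ℝ} (hp₀ : 0 < p) (hp₁ : p < 1) {x : ℝ} (hx : 0 ≤ x) :
    IntegrableOn (fun t : ℝ => min x t * t ^ (p - 2)) (Ioi 0) ∧
      ∫ t in Ioi (0 : ℝ), min x t * t ^ (p - 2) = (1 / p + 1 / (1 - p)) * x ^ p := by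
  rcases hx.eq_or_lt with rfl | hx
  · have h : EqOn (fun t : ℝ => min 0 t * t ^ (p - 2)) (fun _ => 0) (Ioi 0) := fun t ht => by
      simp [min_eq_left (mem_Ioi.1 ht).le]
    exact ⟨integrableOn_zero.congr_fun h.symm measurableSet_Ioi, by
      rw [setIntegral_congr_fun measurableSet_Ioi h]; simp [Real.zero_rpow hp₀.ne']⟩
  have e1 : EqOn (fun t : ℝ => t ^ (p - 1)) (fun t => min x t * t ^ (p - 2)) (Ioc 0 x) :=
    fun t ht => by
      simp only [min_eq_right ht.2]
      rw [mul_comm, ← Real.rpow_add_one ht.1.ne']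
      ring_nf
  have e2 : EqOn (fun t : ℝ => x * t ^ (p - 2)) (fun t => min x t * t ^ (p - 2)) (Ioi x) :=
    fun t ht => by simp only [min_eq_left (mem_Ioi.1 ht).le]
  have i1 : IntegrableOn (fun t : ℝ => t ^ (p - 1)) (Ioc 0 x) :=
    (intervalIntegrable_iff_integrableOn_Ioc_of_le hx.le).1
      (intervalIntegral.intervalIntegrable_rpow' (by linarith))
  have i2 : IntegrableOn (fun t : ℝ => x * t ^ (p - 2)) (Ioi x) :=
    (integrableOn_Ioi_rpow_of_lt (by linarith) hx).const_mul x
  have j1 := i1.congr_fun e1 measurableSet_Ioc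
  have j2 := i2.congr_fun e2 measurableSet_Ioi
  rw [← Ioc_union_Ioi_eq_Ioi hx.le]
  refine ⟨j1.union j2, ?_⟩
  rw [setIntegral_union (Ioc_disjoint_Ioi le_rfl) measurableSet_Ioi j1 j2,
    ← setIntegral_congr_fun measurableSet_Ioc e1, ← setIntegral_congr_fun measurableSet_Ioi e2,
    ← intervalIntegral.integral_of_le hx.le, integral_rpow (Or.inl (by linarith)),
    integral_const_mul, integral_Ioi_rpow_of_lt (by linarith) hx]
  have h1 : x ^ (p - 2 + 1) = x ^ p / x := by
    rw [← Real.rpow_sub_one hx.ne']; ring_nf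
  have h2 : p - 2 + 1 ≠ 0 := by linarith
  have h3 : 1 - p ≠ 0 := by linarith
  have h4 : p - 2 + 1 = -(1 - p) := by ring
  rw [h1, h4, sub_add_cancel, Real.zero_rpow hp₀.ne']
  field_simp
  ring

/-- Comparing `∑ min (x i) t` for all `t` compares `∑ x i ^ p`, since `x ^ p` is a mixture of the
functions `min x t`. -/
theorem sum_rpow_le_of_sum_min_le {p : ℝ} (hp₀ : 0 < p) (hp₁ : p < 1) {s : Finset ℕ}
    {x y z : ℕ → ℝ} (hx : ∀ i, 0 ≤ x i) (hy : ∀ i, 0 ≤ y i) (hz : ∀ i, 0 ≤ z i)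
    (h : ∀ t, 0 < t →
      ∑ i ∈ s, min (x i) t ≤ ∑ i ∈ s, min (y i) t + ∑ i ∈ s, min (z i) t) :
    ∑ i ∈ s, x i ^ p ≤ ∑ i ∈ s, y i ^ p + ∑ i ∈ s, z i ^ p := by
  have hint : ∀ w : ℕ → ℝ, (∀ i, 0 ≤ w i) →
      IntegrableOn (fun t : ℝ => (∑ i ∈ s, min (w i) t) * t ^ (p - 2)) (Ioi 0) ∧
      ∫ t in Ioi (0 : ℝ), (∑ i ∈ s, min (w i) t) * t ^ (p - 2) =
        (1 / p + 1 / (1 - p)) * ∑ i ∈ s, w i ^ p := fun w hw => by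
    simp only [Finset.sum_mul]
    refine ⟨integrable_finsetSum _ fun i _ => (min_mul_rpow_integral hp₀ hp₁ (hw i)).1, ?_⟩
    rw [integral_finsetSum _ fun i _ => (min_mul_rpow_integral hp₀ hp₁ (hw i)).1, Finset.mul_sum]
    exact Finset.sum_congr rfl fun i _ => (min_mul_rpow_integral hp₀ hp₁ (hw i)).2
  have hC : 0 < 1 / p + 1 / (1 - p) := by
    have : 0 < 1 - p := by linarith
    positivity
  have hle := setIntegral_mono_on (hint x hx).1 ((hint y hy).1.add (hint z hz).1) measurableSet_Ioi
    fun t ht => by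
      simp only [Pi.add_apply]
      rw [← add_mul]
      exact mul_le_mul_of_nonneg_right (h t ht) (Real.rpow_nonneg (mem_Ioi.1 ht).le _)
  simp only [Pi.add_apply] at hle
  rw [integral_add (hint y hy).1 (hint z hz).1, (hint x hx).2, (hint y hy).2, (hint z hz).2,
    ← mul_add] at hle
  exact le_of_mul_le_mul_left hle hC

end Powers

/-! ### Rotfeld inequality and low-rank perturbations -/

section LinearMaps

open Module
open scoped RealInnerProductSpace

variable {E F : Type*} [NormedAddCommGroup E] [InnerProductSpace ℝ E] [FiniteDimensional ℝ E]
  [NormedAddCommGroup F] [InnerProductSpace ℝ F] [FiniteDimensional ℝ F]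

/-- The Rotfeld trace inequality for `x ↦ x ^ p`. -/
theorem sum_singularValues_rpow_add_le {p : ℝ} (hp₀ : 0 < p) (hp₁ : p < 1) {n : ℕ}
    (hF : finrank ℝ F = n) (hE : n ≤ finrank ℝ E) (A B : E →ₗ[ℝ] F) :
    ∑ i ∈ Finset.range n, (A + B).singularValues i ^ p ≤
      ∑ i ∈ Finset.range n, A.singularValues i ^ p +
        ∑ i ∈ Finset.range n, B.singularValues i ^ p :=
  sum_rpow_le_of_sum_min_le hp₀ hp₁ (A + B).singularValues_nonneg A.singularValues_nonneg
    B.singularValues_nonneg fun _ ht => sum_min_singularValues_add_le hF hE A B ht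

theorem sum_singularValues_rpow_le_of_finrank_range_le {p : ℝ} (hp₀ : 0 < p) {n k : ℕ}
    (hEF : finrank ℝ F ≤ finrank ℝ E) {S T : E →ₗ[ℝ] F} (hS : finrank ℝ S.range ≤ k)
    (h : ∀ x, ‖S x‖ ≤ ‖T x‖) :
    ∑ i ∈ Finset.range n, S.singularValues i ^ p ≤
      ∑ i ∈ Finset.range k, T.singularValues i ^ p := by
  have hzero : ∀ i, k ≤ i → S.singularValues i ^ p = 0 := fun i hi => by
    rw [S.singularValues_eq_zero_iff_le_finrank_range.2 (hS.trans hi), Real.zero_rpow hp₀.ne']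
  calc ∑ i ∈ Finset.range n, S.singularValues i ^ p
      ≤ ∑ i ∈ Finset.range (max n k), S.singularValues i ^ p :=
        Finset.sum_le_sum_of_subset_of_nonneg (Finset.range_mono (le_max_left _ _))
          fun i _ _ => Real.rpow_nonneg (S.singularValues_nonneg i) p
    _ = ∑ i ∈ Finset.range k, S.singularValues i ^ p :=
        (Finset.sum_subset (Finset.range_mono (le_max_right _ _)) fun i _ hi =>
          hzero i (by simpa using hi)).symm
    _ ≤ _ := Finset.sum_le_sum fun i _ => Real.rpow_le_rpow (S.singularValues_nonneg i)
        (singularValues_mono hEF h i) hp₀.le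

/-- A perturbation bound for the Schatten functional at a map of rank at most `k`. -/
theorem sum_singularValues_rpow_add_ge {p : ℝ} (hp₀ : 0 < p) (hp₁ : p < 1) {n k : ℕ}
    (hF : finrank ℝ F = n) (hE : n ≤ finrank ℝ E) (hk : k ≤ n) (T W : E →ₗ[ℝ] F)
    (hT : finrank ℝ T.range ≤ k) :
    ∑ i ∈ Finset.range n, T.singularValues i ^ p +
        ∑ i ∈ Finset.Ico (2 * k) n, W.singularValues i ^ p ≤
      ∑ i ∈ Finset.range n, (T + W).singularValues i ^ p +
        ∑ i ∈ Finset.range k, W.singularValues i ^ p := by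
  have hEF : finrank ℝ F ≤ finrank ℝ E := hF ▸ hE
  let P : F →ₗ[ℝ] F := T.range.starProjection
  have hPn : ∀ y, ‖P y‖ ≤ ‖y‖ := T.range.norm_starProjection_apply_le
  have hPT : T = P ∘ₗ (T + W) + P ∘ₗ (-W) := by
    rw [← LinearMap.comp_add, add_neg_cancel_right]
    ext x
    exact (Submodule.starProjection_eq_self_iff.2 (LinearMap.mem_range_self T x)).symm
  have hPr : ∀ S : E →ₗ[ℝ] F, finrank ℝ (P ∘ₗ S).range ≤ k := fun S => by
    refine (Submodule.finrank_mono ?_).trans hT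
    rintro _ ⟨x, rfl⟩
    exact Submodule.starProjection_apply_mem _ _
  have h1 := sum_singularValues_rpow_add_le hp₀ hp₁ hF hE (P ∘ₗ (T + W)) (P ∘ₗ (-W))
  rw [← hPT] at h1
  have h2 := sum_singularValues_rpow_le_of_finrank_range_le hp₀ (n := n) hEF (hPr (T + W))
    (T := T + W) fun x => hPn _
  have h3 := sum_singularValues_rpow_le_of_finrank_range_le hp₀ (n := n) hEF (hPr (-W))
    (T := W) fun x => by simpa using hPn ((-W) x)
  -- Shift by `k`: subtracting `T`, of rank at most `k`, from `T + W` recovers `W`.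
  have h4 : ∑ i ∈ Finset.Ico (2 * k) n, W.singularValues i ^ p ≤
      ∑ i ∈ Finset.Ico k n, (T + W).singularValues i ^ p := by
    calc _ ≤ ∑ i ∈ Finset.Ico (k + k) (n + k), W.singularValues i ^ p :=
          Finset.sum_le_sum_of_subset_of_nonneg (Finset.Ico_subset_Ico (by omega) (by omega))
            fun i _ _ => Real.rpow_nonneg (W.singularValues_nonneg i) p
      _ = ∑ i ∈ Finset.Ico k n, W.singularValues (i + k) ^ p :=
          (Finset.sum_Ico_add' (fun i => W.singularValues i ^ p) k n k).symm
      _ ≤ _ := Finset.sum_le_sum fun i _ => by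
          refine Real.rpow_le_rpow (W.singularValues_nonneg _) ?_ hp₀.le
          have := singularValues_add_le_of_finrank_range_le hEF (T + W) (-T)
            (m := k) (by rwa [LinearMap.range_neg]) i
          rwa [add_neg_cancel_comm] at this
  rw [← Finset.sum_range_add_sum_Ico (fun i => (T + W).singularValues i ^ p) hk]
  linarith

/-- Rotfeld over the rank-one terms, each with top singular value at most `|c i|`; orthonormality
and signs play no role. -/
theorem sum_singularValues_rpow_diagMap_le {p : ℝ} (hp₀ : 0 < p) (hp₁ : p < 1) {n : ℕ}
    (hF : finrank ℝ F = n) (hE : n ≤ finrank ℝ E) {u : Fin n → F} {v : Fin n → E}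
    (hu : ∀ i, ‖u i‖ ≤ 1) (hv : ∀ i, ‖v i‖ ≤ 1) (c : Fin n → ℝ) :
    ∑ i ∈ Finset.range n, (diagMap u v c).singularValues i ^ p ≤ ∑ i, |c i| ^ p := by
  have hEF : finrank ℝ F ≤ finrank ℝ E := hF ▸ hE
  have hone : ∀ i, ∑ j ∈ Finset.range n,
      (c i • (innerₛₗ ℝ (v i)).smulRight (u i) : E →ₗ[ℝ] F).singularValues j ^ p ≤ |c i| ^ p := by
    intro i
    set R : E →ₗ[ℝ] F := c i • (innerₛₗ ℝ (v i)).smulRight (u i)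
    have hrank : finrank ℝ R.range ≤ 1 := by
      refine (Submodule.finrank_mono (t := Submodule.span ℝ {u i}) ?_).trans
        (finrank_span_le_card _ |>.trans (by simp))
      rintro _ ⟨x, rfl⟩
      exact Submodule.mem_span_singleton.2 ⟨c i * ⟪v i, x⟫, by simp [R, mul_smul]⟩
    refine (sum_singularValues_rpow_le_of_finrank_range_le hp₀ hEF hrank
      fun x => le_rfl).trans ?_
    rw [Finset.sum_range_one]
    refine Real.rpow_le_rpow (R.singularValues_nonneg 0) ?_ hp₀.le
    refine singularValues_le_of_forall_mem hEF R (abs_nonneg _) ⊤ (by simp) fun x _ => ?_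
    have h1 : ‖R x‖ = |c i| * (|⟪v i, x⟫| * ‖u i‖) := by simp [R, norm_smul]
    rw [h1]
    refine mul_le_mul_of_nonneg_left ?_ (abs_nonneg _)
    calc |⟪v i, x⟫| * ‖u i‖ ≤ |⟪v i, x⟫| := mul_le_of_le_one_right (abs_nonneg _) (hu i)
      _ ≤ ‖v i‖ * ‖x‖ := abs_real_inner_le_norm _ _
      _ ≤ ‖x‖ := mul_le_of_le_one_left (norm_nonneg _) (hv i)
  have hsum : ∀ s : Finset (Fin n), ∑ j ∈ Finset.range n,
      (∑ i ∈ s, c i • (innerₛₗ ℝ (v i)).smulRight (u i) : E →ₗ[ℝ] F).singularValues j ^ p ≤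
        ∑ i ∈ s, |c i| ^ p := by
    classical
    intro s
    induction s using Finset.induction_on with
    | empty => simp [Real.zero_rpow hp₀.ne']
    | insert a s ha ih =>
      rw [Finset.sum_insert ha, Finset.sum_insert ha]
      exact (sum_singularValues_rpow_add_le hp₀ hp₁ hF hE _ _).trans (add_le_add (hone a) ih)
  exact hsum Finset.univ

/-- A map `T` of rank exactly `k` can be chosen so that the Schatten functional of `W + T` is
arbitrarily close to the tail of that of `W`. -/
theorem exists_finrank_range_eq_sum_add_le {p : ℝ} (hp₀ : 0 < p) (hp₁ : p < 1) {n k : ℕ}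
    (hF : finrank ℝ F = n) (hE : n ≤ finrank ℝ E) (hk : k ≤ n) (W : E →ₗ[ℝ] F) {ε : ℝ}
    (hε : 0 < ε) :
    ∃ T : E →ₗ[ℝ] F, finrank ℝ T.range = k ∧
      ∑ i ∈ Finset.range n, (W + T).singularValues i ^ p ≤
        k * ε ^ p + ∑ i ∈ Finset.Ico k n, W.singularValues i ^ p := by
  obtain ⟨u, v, hu, hv, hW⟩ := exists_eq_diagMap W hF hE
  -- Cancel the leading singular values; those already zero become `ε`, so that the rank is exactly
  -- `k`.
  let c : Fin n → ℝ := fun i => if (i : ℕ) < k then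
    (if W.singularValues i = 0 then ε else -W.singularValues i) else 0
  have hc : ∀ i : Fin n, (i : ℕ) < k → c i ≠ 0 := fun i hi => by
    simp only [c, hi, if_true]
    split_ifs with h
    exacts [hε.ne', neg_ne_zero.2 h]
  refine ⟨diagMap u v c, le_antisymm ?_ ?_, ?_⟩
  · refine (finrank_range_diagMap_le u v c).trans ?_
    rw [← Finset.card_map Fin.valEmbedding]
    refine (Finset.card_le_card (t := Finset.range k) ?_).trans (by simp)
    intro j
    simp only [Finset.mem_map, Finset.mem_filter, Finset.mem_range]
    rintro ⟨a, ha, rfl⟩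
    by_contra h
    exact ha.2 (if_neg h)
  · let u' : Fin k → F := u ∘ Fin.castLE hk
    have hu' : Orthonormal ℝ u' := hu.comp _ (Fin.castLE_injective hk)
    have h1 := finrank_span_eq_card hu'.linearIndependent
    rw [Fintype.card_fin] at h1
    conv_lhs => rw [← h1]
    refine Submodule.finrank_mono (Submodule.span_le.2 ?_)
    rintro _ ⟨i, rfl⟩
    refine ⟨(c (Fin.castLE hk i))⁻¹ • v (Fin.castLE hk i), ?_⟩
    rw [map_smul, diagMap_apply_orthonormal u hv, inv_smul_smul₀ (hc _ i.2)]
    rfl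
  · have h2 : W + diagMap u v c = diagMap u v ((fun i : Fin n => W.singularValues i) + c) := by
      rw [diagMap_add]
      conv_lhs => rw [hW]
    rw [h2]
    refine (sum_singularValues_rpow_diagMap_le hp₀ hp₁ hF hE (fun i => (hu.1 i).le)
      (fun i => (hv.1 i).le) _).trans ?_
    let g : ℕ → ℝ := fun i => if i < k then ε ^ p else W.singularValues i ^ p
    calc _ ≤ ∑ i : Fin n, g i := Finset.sum_le_sum fun i _ => by
          simp only [g, c, Pi.add_apply]
          split_ifs with h h'
          · simp [h', abs_of_pos hε]
          · simp [Real.zero_rpow hp₀.ne', Real.rpow_nonneg hε.le]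
          · simp [abs_of_nonneg (W.singularValues_nonneg i)]
      _ = ∑ i ∈ Finset.range k, g i + ∑ i ∈ Finset.Ico k n, g i := by
          rw [← Finset.sum_range, Finset.sum_range_add_sum_Ico _ hk]
      _ = _ := by
          congr 1
          · rw [Finset.sum_congr rfl fun i hi => if_pos (Finset.mem_range.1 hi)]
            simp
          · exact Finset.sum_congr rfl fun i hi => if_neg (not_lt.2 (Finset.mem_Ico.1 hi).1)

end LinearMaps

/-! ### The two nullspace conditions for matrices -/

section Matrices

variable {n₁ n₂ m : ℕ}

open Module

theorem rank_eq_finrank_range_toEuclideanLin (X : Matrix (Fin n₁) (Fin n₂) ℝ) :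
    X.rank = finrank ℝ (Matrix.toEuclideanLin X).range :=
  X.rank_eq_finrank_range_toLin (PiLp.basisFun 2 ℝ (Fin n₁)) (PiLp.basisFun 2 ℝ (Fin n₂))

theorem sigma_nonneg (X : Matrix (Fin n₁) (Fin n₂) ℝ) (i : ℕ) : 0 ≤ sigma X i :=
  LinearMap.singularValues_nonneg _ i

theorem sigma_eq_zero_of_le (X : Matrix (Fin n₁) (Fin n₂) ℝ) {i : ℕ} (hi : n₁ ≤ i) :
    sigma X i = 0 := by
  refine (LinearMap.singularValues_eq_zero_iff_le_finrank_range _).2 (le_trans ?_ hi)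
  simpa using (Matrix.toEuclideanLin X).range.finrank_le

theorem eq_zero_of_forall_sigma_eq_zero {X : Matrix (Fin n₁) (Fin n₂) ℝ}
    (h : ∀ i, sigma X i = 0) : X = 0 := by
  have : Matrix.toEuclideanLin X = 0 :=
    (LinearMap.singularValues_eq_zero_iff _).1 (Finsupp.ext h)
  simpa using this

/-- The order-`2k` condition forces `σ_{k+1}(W) > 0` for nonzero `W`, if `0 < k`. -/
theorem eq_zero_of_sigma_eq_zero {p : ℝ} (hp₀ : 0 < p) {k : ℕ} (hk : 0 < k)
    {W : Matrix (Fin n₁) (Fin n₂) ℝ}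
    (h : ∑ i ∈ Finset.range (2 * k), sigma W i ^ p ≤
      ∑ i ∈ Finset.Ico (2 * k) n₁, sigma W i ^ p)
    (hW : sigma W k = 0) : W = 0 := by
  have hanti : Antitone (sigma W) := (Matrix.toEuclideanLin W).singularValues_antitone
  have hz : ∀ i, k ≤ i → sigma W i = 0 := fun i hi =>
    le_antisymm (hW ▸ hanti hi) (sigma_nonneg W i)
  have h0 : ∑ i ∈ Finset.Ico (2 * k) n₁, sigma W i ^ p = 0 := Finset.sum_eq_zero fun i hi => by
    rw [hz i (by have := (Finset.mem_Ico.1 hi).1; omega), Real.zero_rpow hp₀.ne']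
  have h1 : sigma W 0 ^ p ≤ 0 := by
    rw [h0] at h
    exact (Finset.single_le_sum (f := fun i => sigma W i ^ p)
      (fun i _ => Real.rpow_nonneg (sigma_nonneg W i) p)
      (Finset.mem_range.2 (by omega : 0 < 2 * k))).trans h
  have h2 : sigma W 0 = 0 := by
    by_contra hne
    exact absurd (Real.rpow_pos_of_pos ((sigma_nonneg W 0).lt_of_ne' hne) p) (not_lt.2 h1)
  exact eq_zero_of_forall_sigma_eq_zero fun i =>
    le_antisymm (h2 ▸ hanti (Nat.zero_le i)) (sigma_nonneg W i)

theorem schattenPow_lt_schattenPow_add (hn : n₁ ≤ n₂) {p : ℝ} (hp₀ : 0 < p) (hp₁ : p < 1) {k : ℕ}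
    (hk : k ≤ n₁) {X W : Matrix (Fin n₁) (Fin n₂) ℝ} (hX : X.rank = k)
    (h : ∑ i ∈ Finset.range (2 * k), sigma W i ^ p ≤
      ∑ i ∈ Finset.Ico (2 * k) n₁, sigma W i ^ p) (hW : W ≠ 0) :
    schattenPow p X < schattenPow p (X + W) := by
  have hnn : ∀ i, 0 ≤ sigma W i ^ p := fun i => Real.rpow_nonneg (sigma_nonneg W i) p
  have h1 := sum_singularValues_rpow_add_ge hp₀ hp₁ (finrank_euclideanSpace_fin (𝕜 := ℝ))
    (by simpa using hn) hk (Matrix.toEuclideanLin X) (Matrix.toEuclideanLin W)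
    (by rw [← rank_eq_finrank_range_toEuclideanLin, hX])
  rw [← map_add] at h1
  change schattenPow p X + ∑ i ∈ Finset.Ico (2 * k) n₁, sigma W i ^ p ≤
    schattenPow p (X + W) + ∑ i ∈ Finset.range k, sigma W i ^ p at h1
  -- For `k = 0` the condition is vacuous, and strictness comes from the whole spectrum of `W`;
  -- otherwise from the term of index `k < 2 * k`.
  rcases Nat.eq_zero_or_pos k with rfl | hk0
  · have hne : ∃ i, sigma W i ≠ 0 := by
      by_contra! hz
      exact hW (eq_zero_of_forall_sigma_eq_zero hz)
    obtain ⟨i, hi⟩ := hne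
    have hin : i < n₁ := by
      by_contra! hle
      exact hi (sigma_eq_zero_of_le W hle)
    have h2 : 0 < ∑ i ∈ Finset.Ico (2 * 0) n₁, sigma W i ^ p :=
      Finset.sum_pos' (fun i _ => hnn i) ⟨i, by simpa using hin,
        Real.rpow_pos_of_pos ((sigma_nonneg W i).lt_of_ne' hi) p⟩
    simp only [Finset.range_zero, Finset.sum_empty] at h1
    linarith
  · have h2 : 0 < sigma W k ^ p := Real.rpow_pos_of_pos ((sigma_nonneg W k).lt_of_ne'
      fun h0 => hW (eq_zero_of_sigma_eq_zero hp₀ hk0 h h0)) p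
    have h3 := Finset.sum_range_succ (fun i => sigma W i ^ p) k
    have h4 : ∑ i ∈ Finset.range (k + 1), sigma W i ^ p ≤
        ∑ i ∈ Finset.range (2 * k), sigma W i ^ p :=
      Finset.sum_le_sum_of_subset_of_nonneg (Finset.range_mono (by omega)) fun i _ _ => hnn i
    linarith

theorem sum_sigma_rpow_le_of_isGlobalMinimizer (hn : n₁ ≤ n₂)
    (𝒜 : Matrix (Fin n₁) (Fin n₂) ℝ →ₗ[ℝ] (Fin m → ℝ)) {p : ℝ} (hp₀ : 0 < p) (hp₁ : p < 1)
    {k : ℕ} (hk : k ≤ n₁)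
    (h : ∀ X₀ : Matrix (Fin n₁) (Fin n₂) ℝ, X₀.rank = k → IsGlobalMinimizer 𝒜 p (𝒜 X₀) X₀)
    {W : Matrix (Fin n₁) (Fin n₂) ℝ} (hW : 𝒜 W = 0) :
    ∑ i ∈ Finset.range k, sigma W i ^ p ≤ ∑ i ∈ Finset.Ico k n₁, sigma W i ^ p := by
  refine le_of_forall_pos_le_add fun δ hδ => ?_
  have hb : 0 < δ / (2 * (k + 1)) := by positivity
  -- Chosen so that `2 * k * ε ^ p = δ * k / (k + 1) ≤ δ`.
  set ε : ℝ := (δ / (2 * (k + 1))) ^ p⁻¹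
  have hε : 0 < ε := Real.rpow_pos_of_pos hb _
  have hεp : ε ^ p = δ / (2 * (k + 1)) := Real.rpow_inv_rpow hb.le hp₀.ne'
  have hF : finrank ℝ (EuclideanSpace ℝ (Fin n₁)) = n₁ := finrank_euclideanSpace_fin
  have hE : n₁ ≤ finrank ℝ (EuclideanSpace ℝ (Fin n₂)) := by simpa using hn
  obtain ⟨T, hTr, hTs⟩ := exists_finrank_range_eq_sum_add_le hp₀ hp₁ hF hE hk
    (Matrix.toEuclideanLin W) hε
  obtain ⟨X, rfl⟩ := (Matrix.toEuclideanLin (𝕜 := ℝ) (m := Fin n₁) (n := Fin n₂)).surjective T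
  rw [← rank_eq_finrank_range_toEuclideanLin] at hTr
  have hneg : ∀ i, (Matrix.toEuclideanLin (-X)).singularValues i ≤
      (Matrix.toEuclideanLin X).singularValues i :=
    singularValues_mono (by simpa using hn) fun x => by simp
  rw [← map_add] at hTs
  change schattenPow p (W + X) ≤ k * ε ^ p + ∑ i ∈ Finset.Ico k n₁, sigma W i ^ p at hTs
  have hmin : schattenPow p X ≤ schattenPow p (W + X) := (h X hTr).2 (by simp [hW])
  have hneg' : schattenPow p (-X) ≤ schattenPow p X := Finset.sum_le_sum fun i _ =>
    Real.rpow_le_rpow (sigma_nonneg _ i) (hneg i) hp₀.le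
  -- Rotfeld for `W = (W + X) + (-X)`; both terms are at most `schattenPow p (W + X)`.
  have htri := sum_singularValues_rpow_add_le hp₀ hp₁ hF hE (Matrix.toEuclideanLin (W + X))
    (Matrix.toEuclideanLin (-X))
  rw [← map_add, add_neg_cancel_right] at htri
  change schattenPow p W ≤ schattenPow p (W + X) + schattenPow p (-X) at htri
  have hsplit : schattenPow p W = ∑ i ∈ Finset.range k, sigma W i ^ p +
      ∑ i ∈ Finset.Ico k n₁, sigma W i ^ p :=
    (Finset.sum_range_add_sum_Ico (fun i => sigma W i ^ p) hk).symm
  have hδ' : 2 * (k * ε ^ p) ≤ δ := by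
    rw [hεp]
    have : (0 : ℝ) ≤ k := k.cast_nonneg
    rw [← mul_assoc, mul_div_assoc', div_le_iff₀ (by positivity)]
    nlinarith
  linarith

end Matrices

end SchattenRecovery

/-- First part: under the order-`2k` nullspace condition, every `X₀` of rank `k` is the one and only
global minimizer for the data `𝒜 X₀`. Second part: if every `X₀` of rank `k` is a global minimizer
for the data `𝒜 X₀`, then the order-`k` nullspace condition holds. -/
theorem theorem3 {n₁ n₂ m : ℕ} (hn : n₁ ≤ n₂)
    (𝒜 : Matrix (Fin n₁) (Fin n₂) ℝ →ₗ[ℝ] (Fin m → ℝ))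
    (p : ℝ) (hp₀ : 0 < p) (hp₁ : p < 1) (k : ℕ) (hk : k ≤ n₁) :
    ((∀ W ∈ LinearMap.ker 𝒜,
        ∑ i ∈ Finset.range (2 * k), SchattenRecovery.sigma W i ^ p
          ≤ ∑ i ∈ Finset.Ico (2 * k) n₁, SchattenRecovery.sigma W i ^ p) →
      ∀ X₀ : Matrix (Fin n₁) (Fin n₂) ℝ, X₀.rank = k →
        ∀ X, SchattenRecovery.IsGlobalMinimizer 𝒜 p (𝒜 X₀) X ↔ X = X₀) ∧
    ((∀ X₀ : Matrix (Fin n₁) (Fin n₂) ℝ, X₀.rank = k →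
        SchattenRecovery.IsGlobalMinimizer 𝒜 p (𝒜 X₀) X₀) →
      ∀ W ∈ LinearMap.ker 𝒜,
        ∑ i ∈ Finset.range k, SchattenRecovery.sigma W i ^ p
          ≤ ∑ i ∈ Finset.Ico k n₁, SchattenRecovery.sigma W i ^ p) := by
  refine ⟨fun h X₀ hX₀ X => ?_, fun h W hW =>
    SchattenRecovery.sum_sigma_rpow_le_of_isGlobalMinimizer hn 𝒜 hp₀ hp₁ hk h hW⟩
  have hlt : ∀ Z, 𝒜 Z = 𝒜 X₀ → Z ≠ X₀ →
      SchattenRecovery.schattenPow p X₀ < SchattenRecovery.schattenPow p Z := fun Z hZ hne => by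
    have := SchattenRecovery.schattenPow_lt_schattenPow_add hn hp₀ hp₁ hk hX₀
      (h (Z - X₀) (by simp [hZ])) (sub_ne_zero.2 hne)
    rwa [add_sub_cancel] at this
  constructor
  · rintro ⟨hX, hmin⟩
    by_contra hne
    exact absurd (hmin (show X₀ ∈ {Z | 𝒜 Z = 𝒜 X₀} from rfl)) (not_le.2 (hlt X hX hne))
  · rintro rfl
    refine ⟨rfl, fun Z hZ => ?_⟩
    rcases eq_or_ne Z X with rfl | hne
    · exact le_refl (SchattenRecovery.schattenPow p Z)
    · exact (hlt Z hZ hne).le
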